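/- Let $R$ be a commutative ring, not necessarily Noetherian. A class $\mathfrak{T}$ of $R$-modules is a torsion theory if it contains $0$ and is closed under submodules, quotients, extensions and direct limits. It is half-centered if, whenever $N$ is an $R$-module such that $R/\mathfrak{p}\in\mathfrak{T}$ for all $\mathfrak{p}\in\operatorname{Supp}_R N$, then $N\in\mathfrak{T}$. A prime ideal $\mathfrak{p}$ is weakly associated to an $R$-module $L$ if it is minimal over $(0:_R m)$ for some $m\in L$. An $R$-module is weakly Laskerian if each of its quotients has only finitely many weakly associated primes. For an $R$-module $M$, a finite (possibly empty) sequence $x_1,\dots,x_r$ in $R$ is weakly $M$-regular with respect to $\mathfrak{T}$ if $$\bigl((x_1,\dots,x_{i-1})M:_M x_i\bigr)/(x_1,\dots,x_{i-1})M\in\mathfrak{T}\qquad (1\le i\le r).$$ For an ideal $\mathfrak{a}$ of $R$ let $$\mathfrak{T}\text{-}\mathrm{c.grade}_R(\mathfrak{a},M):=\sup\{\ell\ge 0 : \mathfrak{a}\text{ contains a sequence of length }\ell\text{ that is weakly }M\text{-regular with respect to }\mathfrak{T}\}.$$ If $\mathfrak{a}$ is generated by a finite sequence $\underline{y}=y_1,\dots,y_s$,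 let $\mathbb{K}^\bullet(\underline{y};M)=\operatorname{Hom}_R(\mathbb{K}_\bullet(\underline{y}),M)$, where $\mathbb{K}_\bullet(\underline{y})$ is the Koszul complex, and $$\mathfrak{T}\text{-}\mathrm{K.grade}_R(\mathfrak{a},M):=\inf\{i\ge 0 : H^i(\mathbb{K}^\bullet(\underline{y};M))\notin\mathfrak{T}\},\qquad \inf\emptyset=+\infty.$$ **Theorem.** Let $\mathfrak{T}$ be a half-centered torsion theory of $R$-modules, $\mathfrak{a}$ a finitely generated ideal of $R$ and $M$ a weakly Laskerian $R$-module. Then, for every finite generating sequence $\underline{y}$ of $\mathfrak{a}$ used to compute the right-hand side, $$\mathfrak{T}\text{-}\mathrm{c.grade}_R(\mathfrak{a},M)=\mathfrak{T}\text{-}\mathrm{K.grade}_R(\mathfrak{a},M)$$ in $\{0,1,2,\dots\}\cup\{+\infty\}$. -/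

import Mathlib

open CategoryTheory

universe u

noncomputable section

namespace TorsionGrade

/-! ### Torsion theories and half centered Serre classes -/

/-- A torsion theory: a class of `R`-modules closed under submodules, quotients and extensions
(a Serre class) and under colimits of directed systems. -/
structure IsTorsionTheory {R : Type u} [CommRing R]
    (T : ObjectProperty (ModuleCat.{u} R)) : Prop extends T.IsSerreClass where
  closed_directedColimits : ∀ (J : Type u) [Preorder J] [IsDirectedOrder J] [Nonempty J],
    T.IsClosedUnderColimitsOfShape J

/-- A class `T` is half centered if every module `N` such that `R ⧸ p ∈ T` for all `p ∈ Supp N`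
is itself in `T`. -/
def IsHalfCentered {R : Type u} [CommRing R] (T : ObjectProperty (ModuleCat.{u} R)) : Prop :=
  ∀ N : ModuleCat.{u} R,
    (∀ p ∈ Module.support R N, T (ModuleCat.of R (R ⧸ p.asIdeal))) → T N

/-! ### Weakly associated primes and weakly Laskerian modules -/

/-- The primes that are minimal over the annihilator of some element of `M`. -/
def weaklyAssociatedPrimes (R M : Type u) [CommRing R] [AddCommGroup M] [Module R M] :
    Set (Ideal R) :=
  {p | ∃ m : M, p ∈ (Ideal.torsionOf R M m).minimalPrimes}

/-- Every quotient of `M` has only finitely many weakly associated primes. -/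
def IsWeaklyLaskerian (R M : Type u) [CommRing R] [AddCommGroup M] [Module R M] : Prop :=
  ∀ N : Submodule R M, (weaklyAssociatedPrimes R (M ⧸ N)).Finite

/-! ### Weak regular sequences and the classical grade -/

/-- The submodule `(N :_M x) = {m | x • m ∈ N}`. -/
def colonElem {R M : Type u} [CommRing R] [AddCommGroup M] [Module R M]
    (N : Submodule R M) (x : R) : Submodule R M :=
  N.comap (LinearMap.lsmul R M x)

/-- `x₁, …, xᵣ` is weakly `M`-regular with respect to `T`: for each `i` the module
`((x₁, …, xᵢ₋₁)M :_M xᵢ) / (x₁, …, xᵢ₋₁)M` is in `T` (list positions start at `0`). -/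
def IsWeaklyRegularSeq {R : Type u} [CommRing R] (T : ObjectProperty (ModuleCat.{u} R))
    (M : Type u) [AddCommGroup M] [Module R M] (rs : List R) : Prop :=
  ∀ (i : ℕ) (h : i < rs.length),
    let N : Submodule R M := Ideal.ofList (rs.take i) • ⊤
    T (ModuleCat.of R (colonElem N rs[i] ⧸ N.submoduleOf (colonElem N rs[i])))

/-- The supremum of the lengths of the weakly `M`-regular sequences with respect to `T` in `a`.
The empty sequence always counts, so the supremum lies in `ℕ∞`. -/
def classicalGrade {R : Type u} [CommRing R] (T : ObjectProperty (ModuleCat.{u} R))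
    (a : Ideal R) (M : Type u) [AddCommGroup M] [Module R M] : ℕ∞ :=
  sSup {l : ℕ∞ | ∃ rs : List R,
    (∀ x ∈ rs, x ∈ a) ∧ IsWeaklyRegularSeq T M rs ∧ l = (rs.length : ℕ∞)}

/-! ### The Koszul complex and the Koszul grade -/

/-- The linear form `Rˢ → R` with `eᵢ ↦ yᵢ`. -/
def koszulForm {R : Type u} [CommRing R] {s : ℕ} (y : Fin s → R) : (Fin s → R) →ₗ[R] R :=
  Fintype.linearCombination R y

/-- The differential `⋀ⁿ⁺¹ Rˢ → ⋀ⁿ Rˢ` of the Koszul complex,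
`v₀ ∧ ⋯ ∧ vₙ ↦ ∑ᵢ (-1)ⁱ φ(vᵢ) v₀ ∧ ⋯ ∧ v̂ᵢ ∧ ⋯ ∧ vₙ`, where `φ(eᵢ) = yᵢ`. -/
def koszulD {R : Type u} [CommRing R] {s : ℕ} (y : Fin s → R) (n : ℕ) :
    ⋀[R]^(n + 1) (Fin s → R) →ₗ[R] ⋀[R]^n (Fin s → R) :=
  exteriorPower.alternatingMapLinearEquiv
    (AlternatingMap.alternatizeUncurryFin
      ((koszulForm y).smulRight (exteriorPower.ιMulti R n (M := Fin s → R))))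

theorem koszulD_ιMulti {R : Type u} [CommRing R] {s : ℕ} (y : Fin s → R) (n : ℕ)
    (v : Fin (n + 1) → Fin s → R) :
    koszulD y n (exteriorPower.ιMulti R (n + 1) v) =
      ∑ i : Fin (n + 1), (-1) ^ (i : ℕ) •
        (koszulForm y (v i) • exteriorPower.ιMulti R n (i.removeNth v)) := by
  simp [koszulD, exteriorPower.alternatingMapLinearEquiv_apply_ιMulti,
    AlternatingMap.alternatizeUncurryFin_apply]

theorem koszulD_comp_koszulD {R : Type u} [CommRing R] {s : ℕ} (y : Fin s → R) (n : ℕ) :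
    koszulD y n ∘ₗ koszulD y (n + 1) = 0 := by
  apply exteriorPower.linearMap_ext
  have h := AlternatingMap.alternatizeUncurryFin_alternatizeUncurryFinLM_comp_of_symmetric
    (f := (koszulForm y).smulRight
      ((koszulForm y).smulRight (exteriorPower.ιMulti R n (M := Fin s → R))))
    (fun x z => by ext v; simp [smul_smul, mul_comm])
  ext1 v
  have hv := congrArg (fun g => g v) h
  simp only [AlternatingMap.alternatizeUncurryFin_apply] at hv
  simp only [LinearMap.compAlternatingMap_apply, LinearMap.comp_apply, koszulD_ιMulti, map_sum,
    map_zsmul, map_smul, LinearMap.zero_apply]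
  simpa [koszulD_ιMulti, AlternatingMap.alternatizeUncurryFin_apply] using hv

/-- The Koszul complex `K_•(y)`. -/
def koszulComplex {R : Type u} [CommRing R] {s : ℕ} (y : Fin s → R) :
    ChainComplex (ModuleCat.{u} R) ℕ :=
  ChainComplex.of (fun n => ModuleCat.of R (⋀[R]^n (Fin s → R)))
    (fun n => ModuleCat.ofHom (koszulD y n))
    (fun n => by rw [← ModuleCat.ofHom_comp, koszulD_comp_koszulD]; rfl)

/-- The cochain complex `K^•(y; M) = Hom_R(K_•(y), M)`, whose differential is precomposition with
the differential of `K_•(y)`. -/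
def koszulCochainComplex {R : Type u} [CommRing R] {s : ℕ} (y : Fin s → R)
    (M : Type u) [AddCommGroup M] [Module R M] : CochainComplex (ModuleCat.{u} R) ℕ :=
  CochainComplex.of (fun n => ModuleCat.of R ((koszulComplex y).X n →ₗ[R] M))
    (fun n => ModuleCat.ofHom (LinearMap.lcomp R M ((koszulComplex y).d (n + 1) n).hom))
    (fun n => by
      rw [← ModuleCat.ofHom_comp]
      ext f : 2
      change (f ∘ₗ ((koszulComplex y).d (n + 1) n).hom) ∘ₗ
        ((koszulComplex y).d (n + 1 + 1) (n + 1)).hom = 0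
      rw [LinearMap.comp_assoc, ← ModuleCat.hom_comp, HomologicalComplex.d_comp_d]
      simp)

/-- The Koszul grade, computed from the finite sequence `y`: the infimum of the `i` with
`Hⁱ(K^•(y; M)) ∉ T`, equal to `⊤` if there is no such `i`. -/
def koszulGrade {R : Type u} [CommRing R] (T : ObjectProperty (ModuleCat.{u} R))
    {s : ℕ} (y : Fin s → R) (M : Type u) [AddCommGroup M] [Module R M] : ℕ∞ :=
  sInf {l : ℕ∞ | ∃ i : ℕ, ¬ T ((koszulCochainComplex y M).homology i) ∧ l = (i : ℕ∞)}

end TorsionGrade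

end

/-! Both grades are controlled by one equivalence: `a` contains a weakly regular sequence of length
`l` on `A = M ⧸ N` iff `Hⁱ(y; A) ∈ T` for all `i < l`. The proof is by induction on `l`, for all
submodules `N` at once.

Inductive step (`koszul_homology_quotient`): let `x ∈ a` have kernel `K ∈ T` on `A`. Modulo `T`, the
sequence `0 → K → A → xA → 0` identifies `Hⁱ(A)` with `Hⁱ(xA)`. Multiplication by `x` is zero on
Koszul cohomology, so `0 → xA → A → A/xA → 0` shifts the range of degrees in `T` by exactly one.

Existence of `x` (`exists_mem_prop_ker_lsmul`): if `H⁰ ∈ T`, then `(0 :_A a) ∈ T`, and so `a` lies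
in no weakly associated prime `p` of `A` with `R ⧸ p ∉ T`. There are finitely many such `p`, so
prime avoidance gives `x ∈ a` outside all of them, and half-centeredness puts the kernel of `x` in
`T`. -/

namespace TorsionGrade

/-! ### Koszul cohomology: functoriality, exactness, annihilation by the ideal -/

section Koszul

variable {R : Type u} [CommRing R] {s : ℕ} (y : Fin s → R)

/-- Left exterior multiplication by `e`. -/
noncomputable def wedgeLeft (e : Fin s → R) (n : ℕ) :
    ⋀[R]^n (Fin s → R) →ₗ[R] ⋀[R]^(n + 1) (Fin s → R) :=
  exteriorPower.alternatingMapLinearEquiv ((exteriorPower.ιMulti R (n + 1)).curryLeft e)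

theorem wedgeLeft_ιMulti (e : Fin s → R) (n : ℕ) (v : Fin n → Fin s → R) :
    wedgeLeft e n (exteriorPower.ιMulti R n v) =
      exteriorPower.ιMulti R (n + 1) (Matrix.vecCons e v) := by
  simp [wedgeLeft, exteriorPower.alternatingMapLinearEquiv_apply_ιMulti]

theorem koszulD_comp_wedgeLeft_zero (e : Fin s → R) :
    koszulD y 0 ∘ₗ wedgeLeft e 0 = koszulForm y e • LinearMap.id := by
  apply exteriorPower.linearMap_ext
  ext1 v
  simp only [LinearMap.compAlternatingMap_apply, LinearMap.comp_apply, wedgeLeft_ιMulti,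
    koszulD_ιMulti, LinearMap.smul_apply, LinearMap.id_apply]
  rw [Fin.sum_univ_one]
  simp [Matrix.vecCons]

/-- Cartan's formula: in `d(e ∧ v)` the term omitting `e` gives `φ(e) v`, and the others cancel
against `e ∧ dv` by the index shift in the sign. -/
theorem koszulD_comp_wedgeLeft_succ (e : Fin s → R) (n : ℕ) :
    koszulD y (n + 1) ∘ₗ wedgeLeft e (n + 1) + wedgeLeft e n ∘ₗ koszulD y n =
      koszulForm y e • LinearMap.id := by
  apply exteriorPower.linearMap_ext
  ext1 v
  simp only [LinearMap.compAlternatingMap_apply, LinearMap.comp_apply, wedgeLeft_ιMulti,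
    koszulD_ιMulti, LinearMap.smul_apply, LinearMap.id_apply, LinearMap.add_apply, map_sum,
    map_zsmul, map_smul]
  rw [Fin.sum_univ_succ, add_assoc, ← Finset.sum_add_distrib, Finset.sum_eq_zero, add_zero]
  · simp [Matrix.vecCons]
  · intro i _
    have h : i.succ.removeNth (Matrix.vecCons e v) = Matrix.vecCons e (i.removeNth v) := by
      ext1 j
      refine Fin.cases ?_ (fun j => ?_) j <;> simp [Fin.removeNth_apply]
    rw [h]
    simp [pow_succ]

theorem koszulCochainComplex_d (M : Type u) [AddCommGroup M] [Module R M] (n : ℕ) :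
    (koszulCochainComplex y M).d n (n + 1) =
      ModuleCat.ofHom (LinearMap.lcomp R M (koszulD y n)) := by
  have h : (koszulComplex y).d (n + 1) n = ModuleCat.ofHom (koszulD y n) :=
    ChainComplex.of_d (fun n => ModuleCat.of R (⋀[R]^n (Fin s → R)))
      (fun n => ModuleCat.ofHom (koszulD y n)) n
  have h' : (koszulCochainComplex y M).d n (n + 1) =
      ModuleCat.ofHom (LinearMap.lcomp R M ((koszulComplex y).d (n + 1) n).hom) :=
    CochainComplex.of_d (fun n => ModuleCat.of R ((koszulComplex y).X n →ₗ[R] M))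
      (fun n => ModuleCat.ofHom (LinearMap.lcomp R M ((koszulComplex y).d (n + 1) n).hom)) n
  rw [h', h]
  rfl

variable {M N P : Type u} [AddCommGroup M] [Module R M] [AddCommGroup N] [Module R N]
  [AddCommGroup P] [Module R P]

/-- The Koszul cochain complex is functorial in the module. -/
noncomputable def koszulMap (f : M →ₗ[R] N) :
    koszulCochainComplex y M ⟶ koszulCochainComplex y N where
  f n := ModuleCat.ofHom (LinearMap.compRight R (M := ⋀[R]^n (Fin s → R)) f)
  comm' i j hij := by
    obtain rfl : i + 1 = j := hij
    rw [koszulCochainComplex_d, koszulCochainComplex_d]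
    rfl

theorem koszulMap_comp (f : M →ₗ[R] N) (g : N →ₗ[R] P) :
    koszulMap y (g ∘ₗ f) = koszulMap y f ≫ koszulMap y g := rfl

theorem koszulMap_zero : koszulMap y (0 : M →ₗ[R] N) = 0 := by
  ext n : 2
  ext f
  exact LinearMap.zero_comp f

/-- The short complex of Koszul complexes attached to two composable maps. -/
noncomputable def koszulShortComplex (f : M →ₗ[R] N) (g : N →ₗ[R] P) (h : Function.Exact f g) :
    ShortComplex (CochainComplex (ModuleCat.{u} R) ℕ) :=
  ShortComplex.mk (koszulMap y f) (koszulMap y g) (by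
    rw [← koszulMap_comp, h.linearMap_comp_eq_zero, koszulMap_zero])

theorem koszulShortComplex_shortExact {f : M →ₗ[R] N} {g : N →ₗ[R] P} (h : Function.Exact f g)
    (hf : Function.Injective f) (hg : Function.Surjective g) :
    (koszulShortComplex y f g h).ShortExact := by
  refine HomologicalComplex.shortExact_of_degreewise_shortExact _ fun n => ?_
  refine { exact := ?_, mono_f := ?_, epi_g := ?_ }
  · rw [ShortComplex.ShortExact.moduleCat_exact_iff_function_exact]
    intro (b : ⋀[R]^n (Fin s → R) →ₗ[R] N)
    constructor
    · intro (hb : g ∘ₗ b = 0)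
      have hb' : ∀ w, b w ∈ LinearMap.range f := fun w => (h (b w)).mp (LinearMap.congr_fun hb w)
      let e := LinearEquiv.ofInjective f hf
      refine ⟨e.symm.toLinearMap ∘ₗ b.codRestrict _ hb', LinearMap.ext fun w => ?_⟩
      exact congrArg Subtype.val (e.apply_symm_apply ⟨b w, hb' w⟩)
    · rintro ⟨(a : ⋀[R]^n (Fin s → R) →ₗ[R] M), rfl⟩
      exact LinearMap.ext fun w => h.apply_apply_eq_zero (a w)
  · rw [ModuleCat.mono_iff_injective]
    intro a b hab
    exact LinearMap.ext fun x => hf (LinearMap.congr_fun hab x)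
  · rw [ModuleCat.epi_iff_surjective]
    intro (b : ⋀[R]^n (Fin s → R) →ₗ[R] P)
    -- Exterior powers of a finite free module are projective.
    exact Module.projective_lifting_property g b hg

/-- Write `x = φ(e)`; precomposition with `e ∧ ·` is a homotopy from multiplication by `x` to zero.
-/
theorem homologyMap_koszulMap_smul (x : R) (hx : x ∈ Ideal.span (Set.range y)) (i : ℕ) :
    HomologicalComplex.homologyMap (koszulMap y (LinearMap.lsmul R M x)) i = 0 := by
  obtain ⟨e, rfl⟩ : ∃ e, koszulForm y e = x := by
    have : x ∈ LinearMap.range (koszulForm y) := by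
      rwa [koszulForm, Fintype.range_linearCombination]
    exact this
  let h : ∀ i j : ℕ, (ComplexShape.up ℕ).Rel j i →
      ((koszulCochainComplex y M).X i ⟶ (koszulCochainComplex y M).X j) := fun i j hij =>
    eqToHom (by rw [show i = j + 1 from (Eq.symm hij)]; rfl) ≫
      ModuleCat.ofHom (LinearMap.lcomp R M (wedgeLeft e j))
  have key : koszulMap y (LinearMap.lsmul R M (koszulForm y e)) =
      Homotopy.nullHomotopicMap' h := by
    ext n : 1
    cases n with
    | zero =>
      rw [Homotopy.nullHomotopicMap'_f_of_not_rel_right (k₁ := 0) (k₀ := 1) rfl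
        (by simp), koszulCochainComplex_d]
      ext (f : ⋀[R]^_ (Fin s → R) →ₗ[R] M)
      refine LinearMap.ext fun w => ?_
      have := LinearMap.congr_fun (koszulD_comp_wedgeLeft_zero y e) w
      exact ((congrArg f this).trans (map_smul f _ w)).symm
    | succ n =>
      rw [Homotopy.nullHomotopicMap'_f (k₂ := n) (k₁ := n + 1) (k₀ := n + 2) rfl rfl,
        koszulCochainComplex_d, koszulCochainComplex_d]
      ext (f : ⋀[R]^_ (Fin s → R) →ₗ[R] M)
      refine LinearMap.ext fun w => ?_
      have := LinearMap.congr_fun (koszulD_comp_wedgeLeft_succ y e n) w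
      exact ((map_add f _ _).symm.trans ((congrArg f this).trans (map_smul f _ w))).symm
  rw [key, (Homotopy.nullHomotopy' h).homologyMap_eq, HomologicalComplex.homologyMap_zero]

/-- `(0 :_M a)` embeds in the zeroth Koszul cohomology. -/
theorem exists_mono_homology_zero (L : Submodule R M)
    (hL : ∀ m ∈ L, ∀ i, y i • m = 0) :
    ∃ f : ModuleCat.of R L ⟶ (koszulCochainComplex y M).homology 0, Mono f := by
  let k : ModuleCat.of R L ⟶ (koszulCochainComplex y M).X 0 :=
    ModuleCat.ofHom (LinearMap.lcomp R M (exteriorPower.zeroEquiv R (Fin s → R)).toLinearMap ∘ₗ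
      (LinearMap.ringLmapEquivSelf R R M).symm.toLinearMap ∘ₗ L.subtype)
  have hk : k ≫ (koszulCochainComplex y M).d 0 1 = 0 := by
    rw [koszulCochainComplex_d]
    ext m
    apply exteriorPower.linearMap_ext
    ext1 v
    change exteriorPower.zeroEquiv R (Fin s → R) (koszulD y 0 (exteriorPower.ιMulti R 1 v)) •
      (m : M) = 0
    rw [koszulD_ιMulti, Fin.sum_univ_one]
    simp only [map_zsmul, map_smul, exteriorPower.zeroEquiv_ιMulti]
    simp [koszulForm, Fintype.linearCombination_apply, Finset.sum_smul, mul_smul, hL m m.2]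
  have : Mono k := by
    rw [ModuleCat.mono_iff_injective]
    intro m m' h
    have := LinearMap.congr_fun h (exteriorPower.ιMulti R 0 ![])
    change exteriorPower.zeroEquiv R (Fin s → R) (exteriorPower.ιMulti R 0 ![]) • (m : M) =
      exteriorPower.zeroEquiv R (Fin s → R) (exteriorPower.ιMulti R 0 ![]) • (m' : M) at this
    simpa using this
  let c := (koszulCochainComplex y M).liftCycles k 1 (by simp) hk
  have : Mono c := by
    have : Mono (c ≫ (koszulCochainComplex y M).iCycles 0) := by
      simpa only [c, HomologicalComplex.liftCycles_i] using ‹Mono k›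
    exact mono_of_mono c ((koszulCochainComplex y M).iCycles 0)
  exact ⟨c ≫ (koszulCochainComplex y M).homologyπ 0, inferInstance⟩

end Koszul

/-! ### Koszul cohomology modulo a Serre class -/

section Serre

variable {R : Type u} [CommRing R] {T : ObjectProperty (ModuleCat.{u} R)} [T.IsSerreClass]
  {A B K M N P : Type u} [AddCommGroup A] [Module R A] [AddCommGroup B] [Module R B]
  [AddCommGroup K] [Module R K] [AddCommGroup M] [Module R M]
  [AddCommGroup N] [Module R N] [AddCommGroup P] [Module R P]

theorem prop_of_injective (f : M →ₗ[R] N) (hf : Function.Injective f)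
    (h : T (ModuleCat.of R N)) : T (ModuleCat.of R M) :=
  haveI : Mono (ModuleCat.ofHom f) := (ModuleCat.mono_iff_injective _).mpr hf
  T.prop_of_mono (ModuleCat.ofHom f) h

theorem prop_of_surjective (f : M →ₗ[R] N) (hf : Function.Surjective f)
    (h : T (ModuleCat.of R M)) : T (ModuleCat.of R N) :=
  haveI : Epi (ModuleCat.ofHom f) := (ModuleCat.epi_iff_surjective _).mpr hf
  T.prop_of_epi (ModuleCat.ofHom f) h

theorem prop_of_exact (f : M →ₗ[R] N) (g : N →ₗ[R] P) (h : Function.Exact f g)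
    (hM : T (ModuleCat.of R M)) (hP : T (ModuleCat.of R P)) : T (ModuleCat.of R N) :=
  T.prop_X₂_of_exact (ModuleCat.shortComplex_exact
    (ModuleCat.shortComplexOfCompEqZero f g h.linearMap_comp_eq_zero) h) hM hP

theorem prop_linearMap_pi {n : ℕ} (h : T (ModuleCat.of R M)) :
    T (ModuleCat.of R (Fin n → M)) := by
  induction n with
  | zero =>
    have : Subsingleton (Fin 0 → M) := inferInstance
    exact prop_of_injective (0 : (Fin 0 → M) →ₗ[R] M) (Function.injective_of_subsingleton _) h
  | succ n ih =>
    let f : M →ₗ[R] (Fin (n + 1) → M) := LinearMap.single R (fun _ => M) 0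
    let g : (Fin (n + 1) → M) →ₗ[R] (Fin n → M) := LinearMap.funLeft R M Fin.succ
    refine prop_of_exact f g (fun v => ⟨fun hv => ⟨v 0, ?_⟩, ?_⟩) h ih
    · ext j
      refine Fin.cases ?_ (fun j => ?_) j
      · simp [f]
      · have := congrFun hv j
        simpa [f, g, LinearMap.funLeft_apply] using this.symm
    · rintro ⟨m, rfl⟩
      ext j
      simp [f, g, LinearMap.funLeft_apply]

variable {s : ℕ} (y : Fin s → R)

theorem prop_koszul_homology (h : T (ModuleCat.of R M)) (i : ℕ) :
    T ((koszulCochainComplex y M).homology i) := by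
  have hX : T ((koszulCochainComplex y M).X i) := by
    -- Evaluation at `n` generators embeds the cochains in `Mⁿ`.
    obtain ⟨n, π, hπ⟩ := Module.Finite.exists_fin' R (⋀[R]^i (Fin s → R))
    let e : (⋀[R]^i (Fin s → R) →ₗ[R] M) →ₗ[R] (Fin n → M) :=
      LinearMap.pi fun t => LinearMap.applyₗ (π (Pi.single t 1))
    refine prop_of_injective e (fun f f' hff => ?_) (prop_linearMap_pi h)
    refine (LinearMap.cancel_right hπ).mp ?_
    refine LinearMap.pi_ext' fun t => LinearMap.ext_ring ?_
    exact congrFun hff t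
  have := T.prop_of_mono ((koszulCochainComplex y M).iCycles i) hX
  exact T.prop_of_epi ((koszulCochainComplex y M).homologyπ i) this

/-- Nothing maps into degree `0`, so `H⁰` is the module of cycles. -/
theorem mono_homologyMap_zero {C D : CochainComplex (ModuleCat.{u} R) ℕ} (f : C ⟶ D)
    (hf : Mono f) : Mono (HomologicalComplex.homologyMap f 0) := by
  have : Mono (C.homologyπ 0 ≫ HomologicalComplex.homologyMap f 0) := by
    rw [HomologicalComplex.homologyπ_naturality]
    infer_instance
  have h : HomologicalComplex.homologyMap f 0 = inv (C.homologyπ 0) ≫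
      (C.homologyπ 0 ≫ HomologicalComplex.homologyMap f 0) := by simp
  rw [h]
  infer_instance

/-- In an exact sequence `X₁ ⟶ X₂ ⟶ X₃`, if the second map becomes zero after composing with a
map whose kernel is in `T` and `X₁` is in `T`, then so is `X₂`. -/
theorem prop_X₂_of_exact_of_comp_eq_zero {S : ShortComplex (ModuleCat.{u} R)} (hS : S.Exact)
    {Y : ModuleCat.{u} R} (j : S.X₃ ⟶ Y) (h : S.g ≫ j = 0) (h₁ : T S.X₁)
    (hj : T (Limits.kernel j)) : T S.X₂ := by
  let S' : ShortComplex (ModuleCat.{u} R) :=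
    ShortComplex.mk S.f (Limits.kernel.lift j S.g h)
      ((cancel_mono (Limits.kernel.ι j)).mp (by simp))
  let φ : S' ⟶ S := { τ₁ := 𝟙 _, τ₂ := 𝟙 _, τ₃ := Limits.kernel.ι j }
  have : Epi φ.τ₁ := inferInstanceAs (Epi (𝟙 _))
  have : IsIso φ.τ₂ := inferInstanceAs (IsIso (𝟙 _))
  have : Mono φ.τ₃ := inferInstanceAs (Mono (Limits.kernel.ι j))
  have hS' : S'.Exact := (ShortComplex.exact_iff_of_epi_of_isIso_of_mono φ).mpr hS
  exact T.prop_X₂_of_exact (S := S') hS' h₁ hj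

variable {x : R} {k : K →ₗ[R] A} {g : A →ₗ[R] B}

/-- If `x ∈ (y)`, the kernel of multiplication by `x` on `A` is in `T` and `B = A / x A`, then
the Koszul cohomology of `A` is in `T` up to degree `l` iff that of `B` is below degree `l`. -/
theorem koszul_homology_quotient (hx : x ∈ Ideal.span (Set.range y))
    (hk : Function.Injective k) (hkx : Function.Exact k (LinearMap.lsmul R A x))
    (hxg : Function.Exact (LinearMap.lsmul R A x) g) (hg : Function.Surjective g)
    (hK : T (ModuleCat.of R K)) (l : ℕ) :
    (∀ i < l + 1, T ((koszulCochainComplex y A).homology i)) ↔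
      ∀ i < l, T ((koszulCochainComplex y B).homology i) := by
  let q := (LinearMap.lsmul R A x).rangeRestrict
  let j := (LinearMap.range (LinearMap.lsmul R A x)).subtype
  have hkq : Function.Exact k q := fun a => by
    rw [← hkx a]
    exact Subtype.ext_iff
  have hjg : Function.Exact j g := fun a => by
    rw [hxg a]
    simp [j]
  have h₁ := koszulShortComplex_shortExact y hkq hk (LinearMap.surjective_rangeRestrict _)
  have h₂ := koszulShortComplex_shortExact y hjg (Submodule.subtype_injective _) hg
  have hKi := fun i => prop_koszul_homology y hK i
  constructor
  · intro h i hi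
    -- `Hⁱ(B)` lies between `Hⁱ(A)` and `Hⁱ⁺¹(xA)`, and the latter between `Hⁱ⁺¹(A)` and `Hⁱ⁺²(K)`.
    refine T.prop_X₂_of_exact (h₂.homology_exact₃ i (i + 1) rfl) (h i (by omega)) ?_
    exact T.prop_X₂_of_exact (h₁.homology_exact₃ (i + 1) (i + 2) rfl) (h (i + 1) (by omega))
      (hKi _)
  · intro h i hi
    -- Multiplication by `x` factors as `A → xA → A`.
    have hzero : HomologicalComplex.homologyMap (koszulMap y q) i ≫
        HomologicalComplex.homologyMap (koszulMap y j) i = 0 := by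
      rw [← HomologicalComplex.homologyMap_comp, ← koszulMap_comp]
      exact homologyMap_koszulMap_smul y x hx i
    -- This kernel is the image of the connecting map from `Hⁱ⁻¹(B)`, and is zero for `i = 0`.
    have hker : T (Limits.kernel (HomologicalComplex.homologyMap (koszulMap y j) i)) := by
      cases i with
      | zero =>
        have := mono_homologyMap_zero (koszulMap y j) (h₂.mono_f)
        exact T.prop_of_isZero (Limits.isZero_kernel_of_mono _)
      | succ i =>
        have : Epi (Limits.kernel.lift (HomologicalComplex.homologyMap (koszulMap y j)
            (i + 1)) (h₂.δ i (i + 1) rfl) (h₂.δ_comp i (i + 1) rfl)) :=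
          (h₂.homology_exact₁ i (i + 1) rfl).epi_kernelLift
        exact T.prop_of_epi (Limits.kernel.lift (HomologicalComplex.homologyMap (koszulMap y j)
          (i + 1)) (h₂.δ i (i + 1) rfl) (h₂.δ_comp i (i + 1) rfl)) (h i (by omega))
    exact prop_X₂_of_exact_of_comp_eq_zero (h₁.homology_exact₂ i) _ hzero (hKi i) hker

end Serre

/-! ### Weakly associated primes and the choice of a regular element -/

section PrimeAvoidance

variable {R : Type u} [CommRing R] {T : ObjectProperty (ModuleCat.{u} R)} [T.IsSerreClass]
  {A : Type u} [AddCommGroup A] [Module R A]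

theorem prop_quotient_of_torsionOf_le (h : T (ModuleCat.of R A)) {m : A} {p : Ideal R}
    (hp : Ideal.torsionOf R A m ≤ p) : T (ModuleCat.of R (R ⧸ p)) := by
  have : T (ModuleCat.of R (R ⧸ Ideal.torsionOf R A m)) :=
    prop_of_injective ((LinearMap.ker (LinearMap.toSpanSingleton R A m)).liftQ
      (LinearMap.toSpanSingleton R A m) le_rfl)
      (LinearMap.ker_eq_bot.mp (Submodule.ker_liftQ_eq_bot _ _ _ le_rfl)) h
  exact prop_of_surjective (Submodule.factor hp) (Submodule.factor_surjective hp) this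

/-- Otherwise some prime over `I` avoids both the complement of `p` and the powers of `x`; it lies
in `p` and misses `x`, against minimality. -/
theorem exists_mul_pow_mem_of_mem_minimalPrimes {I p : Ideal R} (hp : p ∈ I.minimalPrimes)
    {x : R} (hx : x ∈ p) : ∃ c ∉ p, ∃ n : ℕ, c * x ^ n ∈ I := by
  have : p.IsPrime := hp.1.1
  by_contra! h
  have hd : Disjoint (I : Set R) (p.primeCompl ⊔ Submonoid.powers x : Submonoid R) := by
    refine Set.disjoint_left.mpr fun z hz hz' => ?_
    obtain ⟨c, hc, _, ⟨n, rfl⟩, rfl⟩ := Submonoid.mem_sup.mp hz'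
    exact h c hc n hz
  obtain ⟨q, hq, hIq, hqd⟩ := Ideal.exists_le_prime_disjoint I _ hd
  have hqp : q ≤ p := fun z hz => by
    by_contra hzp
    exact Set.disjoint_left.mp hqd hz
      ((le_sup_left : p.primeCompl ≤ p.primeCompl ⊔ Submonoid.powers x) hzp)
  exact Set.disjoint_left.mp hqd (hp.2 ⟨hq, hIq⟩ hqp hx)
    ((le_sup_right : _ ≤ p.primeCompl ⊔ Submonoid.powers x) (Submonoid.mem_powers x))

/-- A weakly associated prime need not be an annihilator, but finitely many of its elements can be
made to kill a suitable multiple of `m`, one at a time. -/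
theorem exists_torsionOf_le_of_smul_eq_zero {s : ℕ} (y : Fin s → R) {m : A} {p : Ideal R}
    (hp : p ∈ (Ideal.torsionOf R A m).minimalPrimes) (hy : ∀ i, y i ∈ p) :
    ∃ m' : A, Ideal.torsionOf R A m' ≤ p ∧ ∀ i, y i • m' = 0 := by
  have : p.IsPrime := hp.1.1
  suffices h : ∀ F : Finset (Fin s), ∃ m' : A, Ideal.torsionOf R A m ≤ Ideal.torsionOf R A m' ∧
      Ideal.torsionOf R A m' ≤ p ∧ ∀ i ∈ F, y i • m' = 0 by
    obtain ⟨m', -, h₁, h₂⟩ := h Finset.univ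
    exact ⟨m', h₁, fun i => h₂ i (Finset.mem_univ i)⟩
  intro F
  induction F using Finset.induction_on with
  | empty => exact ⟨m, le_rfl, hp.1.2, by simp⟩
  | insert i F _ ih =>
    obtain ⟨m₁, h₁, h₂, h₃⟩ := ih
    -- Since annihilators only grow while staying inside `p`, minimality of `p` persists.
    have hp₁ : p ∈ (Ideal.torsionOf R A m₁).minimalPrimes :=
      ⟨⟨this, h₂⟩, fun q hq hqp => hp.2 ⟨hq.1, h₁.trans hq.2⟩ hqp⟩
    have hn : ∃ n : ℕ, ∃ c ∉ p, c • y i ^ n • m₁ = 0 := by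
      obtain ⟨c, hc, n, hcn⟩ := exists_mul_pow_mem_of_mem_minimalPrimes hp₁ (hy i)
      exact ⟨n, c, hc, by rwa [← mul_smul, ← Ideal.mem_torsionOf_iff]⟩
    classical
    obtain ⟨c, hc, hcn⟩ := Nat.find_spec hn
    have hmin := fun k => Nat.find_min hn (m := k)
    generalize Nat.find hn = n at hcn hmin
    cases n with
    | zero => exact absurd (h₂ (by simpa using hcn)) hc
    | succ n =>
      -- The exponent `n + 1` is least, so an `r ∉ p` killing this element would make `r * c` a
      -- witness for `n`.
      refine ⟨c • y i ^ n • m₁, fun r hr => ?_, fun r hr => ?_, fun j hj => ?_⟩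
      · rw [Ideal.mem_torsionOf_iff] at hr ⊢
        have := h₁ hr
        rw [Ideal.mem_torsionOf_iff] at this
        rw [smul_comm r, smul_comm r, this, smul_zero, smul_zero]
      · rw [Ideal.mem_torsionOf_iff] at hr
        by_contra hrp
        exact hmin n n.lt_succ_self 
          ⟨r * c, Ideal.IsPrime.mul_notMem this hrp hc, by rw [mul_smul, hr]⟩
      · rcases Finset.mem_insert.mp hj with rfl | hj
        · rw [smul_comm, ← mul_smul (y j), ← pow_succ', hcn]
        · rw [smul_comm, smul_comm (y j), h₃ j hj, smul_zero, smul_zero]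

/-- The submodule `(0 :_A (y))`. -/
def annihilatedBy {s : ℕ} (y : Fin s → R) (A : Type u) [AddCommGroup A] [Module R A] :
    Submodule R A :=
  ⨅ i, LinearMap.ker (LinearMap.lsmul R A (y i))

theorem mem_annihilatedBy {s : ℕ} {y : Fin s → R} {m : A} :
    m ∈ annihilatedBy y A ↔ ∀ i, y i • m = 0 := by
  simp [annihilatedBy]

theorem exists_mem_prop_ker_lsmul (hc : IsHalfCentered T) {s : ℕ} (y : Fin s → R)
    (hA : (weaklyAssociatedPrimes R A).Finite)
    (h : T (ModuleCat.of R (annihilatedBy y A))) :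
    ∃ x ∈ Ideal.span (Set.range y),
      T (ModuleCat.of R (LinearMap.ker (LinearMap.lsmul R A x))) := by
  let S : Set (Ideal R) := {p ∈ weaklyAssociatedPrimes R A | ¬ T (ModuleCat.of R (R ⧸ p))}
  have hS : ¬ ((Ideal.span (Set.range y) : Ideal R) : Set R) ⊆
      ⋃ p ∈ S, ((id p : Ideal R) : Set R) := by
    -- All members of `S` are prime, so the two indices exempt from primality are arbitrary.
    rw [Ideal.subset_union_prime_finite (hA.subset (Set.sep_subset _ _)) ⊥ ⊥
      (fun p hp _ _ => by obtain ⟨⟨m, hm⟩, -⟩ := hp; exact hm.1.1)]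
    rintro ⟨p, ⟨⟨m, hm⟩, hpT⟩, hle⟩
    obtain ⟨m', hm', hy'⟩ := exists_torsionOf_le_of_smul_eq_zero y hm
      fun i => hle (Ideal.subset_span ⟨i, rfl⟩)
    refine hpT (prop_quotient_of_torsionOf_le h (m := ⟨m', mem_annihilatedBy.mpr hy'⟩)
      fun r hr => hm' ?_)
    exact congrArg Subtype.val hr
  obtain ⟨x, hx, hxS⟩ := Set.not_subset.mp hS
  refine ⟨x, hx, hc _ fun q hq => ?_⟩
  obtain ⟨m, hm⟩ := Module.mem_support_iff'.mp hq
  have hmq : Ideal.torsionOf R A m ≤ q.asIdeal := fun r hr => by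
    by_contra hrq
    exact hm r hrq (Subtype.ext hr)
  -- As `x` kills `m`, it lies in `p`; hence `p ∉ S`, and `R ⧸ q` is a quotient of `R ⧸ p ∈ T`.
  obtain ⟨p, hp, hpq⟩ := Ideal.exists_minimalPrimes_le hmq
  have hpT : T (ModuleCat.of R (R ⧸ p)) := by
    by_contra hpT
    exact hxS (Set.mem_biUnion (x := p) ⟨⟨m, hp⟩, hpT⟩ (hp.1.2 m.2))
  exact prop_of_surjective (Submodule.factor hpq) (Submodule.factor_surjective hpq) hpT

end PrimeAvoidance

/-! ### Induction along weakly regular sequences -/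

section Grade

variable {R : Type u} [CommRing R] {T : ObjectProperty (ModuleCat.{u} R)}
  {M : Type u} [AddCommGroup M] [Module R M]

/-- The module `(N :_M x) / N`. -/
abbrev colonQuotient (N : Submodule R M) (x : R) : ModuleCat.{u} R :=
  ModuleCat.of R (colonElem N x ⧸ N.submoduleOf (colonElem N x))

/-- The sequence `rs` is weakly regular with respect to `T` on `M ⧸ N`. -/
def IsWeaklyRegularSeqModulo (T : ObjectProperty (ModuleCat.{u} R)) (N : Submodule R M)
    (rs : List R) : Prop :=
  ∀ (i : ℕ) (h : i < rs.length),
    T (colonQuotient (N ⊔ Ideal.ofList (rs.take i) • ⊤) rs[i])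

theorem isWeaklyRegularSeqModulo_bot {rs : List R} :
    IsWeaklyRegularSeqModulo T (⊥ : Submodule R M) rs ↔ IsWeaklyRegularSeq T M rs := by
  simp only [IsWeaklyRegularSeqModulo, bot_sup_eq]
  rfl

theorem isWeaklyRegularSeqModulo_cons {N : Submodule R M} {x : R} {rs : List R} :
    IsWeaklyRegularSeqModulo T N (x :: rs) ↔ T (colonQuotient N x) ∧
      IsWeaklyRegularSeqModulo T (N ⊔ Ideal.span {x} • ⊤) rs := by
  have h (i : ℕ) : N ⊔ Ideal.ofList ((x :: rs).take (i + 1)) • (⊤ : Submodule R M) =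
      N ⊔ Ideal.span {x} • ⊤ ⊔ Ideal.ofList (rs.take i) • ⊤ := by
    rw [List.take_succ_cons, Ideal.ofList_cons, Submodule.sup_smul, sup_assoc]
  constructor
  · refine fun H => ⟨?_, fun i hi => ?_⟩
    · have H₀ := H 0 (by simp)
      rwa [List.take_zero, Ideal.ofList_nil, Submodule.bot_smul, sup_bot_eq] at H₀
    · rw [← h]
      exact H (i + 1) (by simpa using hi)
  · rintro ⟨H₀, H⟩ (_ | i) hi
    · rwa [List.take_zero, Ideal.ofList_nil, Submodule.bot_smul, sup_bot_eq]
    · rw [h]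
      exact H i (by simpa using hi)

/-- The embedding of `(N :_M x) / N` into `M / N`. -/
def colonQuotientMap (N : Submodule R M) (x : R) :
    (colonElem N x ⧸ N.submoduleOf (colonElem N x)) →ₗ[R] M ⧸ N :=
  Submodule.mapQ _ _ (colonElem N x).subtype le_rfl

theorem colonQuotientMap_injective (N : Submodule R M) (x : R) :
    Function.Injective (colonQuotientMap N x) := by
  rw [← LinearMap.ker_eq_bot]
  refine Submodule.ker_liftQ_eq_bot _ _ _ ?_
  rw [LinearMap.ker_comp, Submodule.ker_mkQ]
  rfl

theorem colonQuotientMap_exact (N : Submodule R M) (x : R) :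
    Function.Exact (colonQuotientMap N x) (LinearMap.lsmul R (M ⧸ N) x) := by
  intro m
  obtain ⟨m, rfl⟩ := N.mkQ_surjective m
  have h : LinearMap.lsmul R (M ⧸ N) x (N.mkQ m) = 0 ↔ x • m ∈ N := by
    rw [LinearMap.lsmul_apply, ← map_smul, Submodule.mkQ_apply, Submodule.Quotient.mk_eq_zero]
  rw [h]
  constructor
  · exact fun hm => ⟨Submodule.Quotient.mk ⟨m, hm⟩, rfl⟩
  · rintro ⟨k, hk⟩
    obtain ⟨k, rfl⟩ := Submodule.mkQ_surjective _ k
    rw [← h, ← hk]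
    exact (Submodule.Quotient.mk_eq_zero N).mpr k.2

theorem exact_lsmul_factor (N : Submodule R M) (x : R) :
    Function.Exact (LinearMap.lsmul R (M ⧸ N) x)
      (Submodule.factor (le_sup_left : N ≤ N ⊔ Ideal.span {x} • ⊤)) := by
  intro m
  obtain ⟨m, rfl⟩ := N.mkQ_surjective m
  have h : Submodule.factor (le_sup_left : N ≤ N ⊔ Ideal.span {x} • ⊤) (N.mkQ m) = 0 ↔
      m ∈ N ⊔ Ideal.span {x} • (⊤ : Submodule R M) :=
    Submodule.Quotient.mk_eq_zero _
  rw [h, Submodule.mem_sup]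
  simp only [Submodule.ideal_span_singleton_smul]
  constructor
  · rintro ⟨n, hn, z, hz, rfl⟩
    obtain ⟨w, -, rfl⟩ := hz
    refine ⟨N.mkQ w, ?_⟩
    rw [map_add, Submodule.mkQ_apply N n, (Submodule.Quotient.mk_eq_zero N).mpr hn, zero_add]
    rfl
  · rintro ⟨w, hw⟩
    obtain ⟨w, rfl⟩ := N.mkQ_surjective w
    have hw' : N.mkQ (x • w) = N.mkQ m := by rw [← hw, map_smul]; rfl
    exact ⟨m - x • w, (Submodule.Quotient.eq N).mp hw'.symm, x • w, ⟨w, trivial, rfl⟩, by simp⟩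

variable {s : ℕ} (y : Fin s → R)

theorem natCast_le_koszulGrade_iff (l : ℕ) :
    (l : ℕ∞) ≤ koszulGrade T y M ↔ ∀ i < l, T ((koszulCochainComplex y M).homology i) := by
  rw [koszulGrade, le_sInf_iff]
  constructor
  · intro h i hi
    by_contra hT
    exact absurd (Nat.cast_le.mp (h i ⟨i, hT, rfl⟩)) (not_le.mpr hi)
  · rintro h _ ⟨i, hT, rfl⟩
    by_contra hi
    exact hT (h i (by simpa using hi))

variable [T.IsSerreClass]

theorem prop_homology_quotient_iff {x : R} (hx : x ∈ Ideal.span (Set.range y))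
    (N : Submodule R M) (hN : T (colonQuotient N x)) (l : ℕ) :
    (∀ i < l + 1, T ((koszulCochainComplex y (M ⧸ N)).homology i)) ↔
      ∀ i < l, T ((koszulCochainComplex y (M ⧸ (N ⊔ Ideal.span {x} • ⊤))).homology i) :=
  koszul_homology_quotient y hx (colonQuotientMap_injective N x) (colonQuotientMap_exact N x)
    (exact_lsmul_factor N x) (Submodule.factor_surjective _) hN l

/-- `N` varies because the tail of a sequence `x :: rs` is tested on `M ⧸ (N + xM)`; `hM` covers all
these quotients. -/
theorem exists_isWeaklyRegularSeqModulo_iff (hc : IsHalfCentered T)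
    (hM : IsWeaklyLaskerian R M) (l : ℕ) (N : Submodule R M) :
    (∃ rs : List R, (∀ x ∈ rs, x ∈ Ideal.span (Set.range y)) ∧
      IsWeaklyRegularSeqModulo T N rs ∧ rs.length = l) ↔
      ∀ i < l, T ((koszulCochainComplex y (M ⧸ N)).homology i) := by
  induction l generalizing N with
  | zero => simp [IsWeaklyRegularSeqModulo]
  | succ l ih =>
    constructor
    · rintro ⟨_ | ⟨x, rs⟩, hrs, hreg, hl⟩
      · simp at hl
      · obtain ⟨hx, hreg⟩ := isWeaklyRegularSeqModulo_cons.mp hreg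
        rw [prop_homology_quotient_iff y (hrs x List.mem_cons_self) N hx, ← ih]
        exact ⟨rs, fun z hz => hrs z (List.mem_cons_of_mem _ hz), hreg, by simpa using hl⟩
    · intro h
      obtain ⟨f, _⟩ := exists_mono_homology_zero y (annihilatedBy y (M ⧸ N))
        fun m hm => mem_annihilatedBy.mp hm
      obtain ⟨x, hx, hker⟩ := exists_mem_prop_ker_lsmul hc y (hM N)
        (T.prop_of_mono f (h 0 (Nat.succ_pos l)))
      have hcol : T (colonQuotient N x) :=
        prop_of_injective ((colonQuotientMap N x).codRestrict _
          fun k => (colonQuotientMap_exact N x).apply_apply_eq_zero k)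
          (fun a b hab => colonQuotientMap_injective N x (congrArg Subtype.val hab)) hker
      rw [prop_homology_quotient_iff y hx N hcol, ← ih] at h
      obtain ⟨rs, hrs, hreg, hl⟩ := h
      exact ⟨x :: rs, by simpa using ⟨hx, hrs⟩, isWeaklyRegularSeqModulo_cons.mpr ⟨hcol, hreg⟩,
        by simp [hl]⟩

theorem prop_homology_of_linearEquiv {N : Type u} [AddCommGroup N] [Module R N] (e : M ≃ₗ[R] N)
    {i : ℕ} (h : T ((koszulCochainComplex y N).homology i)) :
    T ((koszulCochainComplex y M).homology i) := by
  let E : koszulCochainComplex y M ≅ koszulCochainComplex y N :=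
    { hom := koszulMap y e.toLinearMap
      inv := koszulMap y e.symm.toLinearMap
      hom_inv_id := by
        rw [← koszulMap_comp, LinearEquiv.comp_coe, LinearEquiv.self_trans_symm]
        rfl
      inv_hom_id := by
        rw [← koszulMap_comp, LinearEquiv.comp_coe, LinearEquiv.symm_trans_self]
        rfl }
  exact T.prop_of_iso (HomologicalComplex.homologyMapIso E i).symm h

theorem exists_isWeaklyRegularSeq_iff (hc : IsHalfCentered T) (hM : IsWeaklyLaskerian R M)
    (l : ℕ) :
    (∃ rs : List R, (∀ x ∈ rs, x ∈ Ideal.span (Set.range y)) ∧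
      IsWeaklyRegularSeq T M rs ∧ rs.length = l) ↔
      ∀ i < l, T ((koszulCochainComplex y M).homology i) := by
  have h := exists_isWeaklyRegularSeqModulo_iff y hc hM l ⊥
  simp only [isWeaklyRegularSeqModulo_bot] at h
  rw [h]
  let e := Submodule.quotEquivOfEqBot (⊥ : Submodule R M) rfl
  exact ⟨fun H i hi => prop_homology_of_linearEquiv y e.symm (H i hi),
    fun H i hi => prop_homology_of_linearEquiv y e (H i hi)⟩

end Grade

end TorsionGrade

theorem theorem4p7 {R : Type u} [CommRing R]
    (T : ObjectProperty (ModuleCat.{u} R))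
    (hT : TorsionGrade.IsTorsionTheory T) (hc : TorsionGrade.IsHalfCentered T)
    (a : Ideal R) (s : ℕ) (y : Fin s → R) (hy : Ideal.span (Set.range y) = a)
    (M : Type u) [AddCommGroup M] [Module R M]
    (hM : TorsionGrade.IsWeaklyLaskerian R M) :
    TorsionGrade.classicalGrade T a M = TorsionGrade.koszulGrade T y M := by
  subst hy
  have : T.IsSerreClass := hT.toIsSerreClass
  apply le_antisymm
  · refine sSup_le ?_
    rintro _ ⟨rs, hrs, hreg, rfl⟩
    exact (TorsionGrade.natCast_le_koszulGrade_iff y _).mpr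
      ((TorsionGrade.exists_isWeaklyRegularSeq_iff y hc hM _).mp ⟨rs, hrs, hreg, rfl⟩)
  -- Testing against natural numbers also covers an infinite Koszul grade.
  · refine ENat.forall_natCast_le_iff_le.mp fun l hl => ?_
    obtain ⟨rs, hrs, hreg, rfl⟩ := (TorsionGrade.exists_isWeaklyRegularSeq_iff y hc hM l).mpr
      ((TorsionGrade.natCast_le_koszulGrade_iff y l).mp hl)
    exact le_sSup ⟨rs, hrs, hreg, rfl⟩
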